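/- Let $K$ be a field and let $n\ge 0$ be an integer. For an ideal $\mathcal I\subseteq K[x_1,\dots,x_n]$, the blowup of $\mathbb A^n_K=\operatorname{Spec}K[x_1,\dots,x_n]$ with center $\mathcal I$ is the scheme $\operatorname{Proj}\bigl(\bigoplus_{d\ge 0}\mathcal I^d\bigr)$ together with its projection to $\mathbb A^n_K$. A monomial ideal $\mathcal I$ is called tame if this blowup is smooth over $K$ (the blowup with center the zero ideal is empty and counts as smooth). A coordinate ideal is an ideal generated by a (possibly empty) subset of $\{x_1,\dots,x_n\}$. Let $N\ge 0$ and let $\mathcal I_1,\dots,\mathcal I_N$ be coordinate ideals in $K[x_1,\dots,x_n]$, not necessarily distinct. Then the ideal $$\prod_{1\le i<j\le N}(\mathcal I_i+\mathcal I_j)$$ is tame. In particular, the ideal $\prod_{1\le i<j\le n}(x_i,x_j)$ is tame. (An empty product of ideals is the unit ideal.) -/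

import Mathlib

open AlgebraicGeometry CategoryTheory

universe u

noncomputable section

/-- The degree `d` part `I ^ d • T ^ d` of the Rees algebra `⨁ I ^ d • T ^ d ⊆ R[T]` of an ideal
`I`: the elements of the Rees algebra of the form `r * T ^ d`. -/
def reesGrading {R : Type u} [CommRing R] (I : Ideal R) (d : ℕ) : Submodule R (reesAlgebra I) :=
  (LinearMap.range (Polynomial.monomial d : R →ₗ[R] Polynomial R)).comap
    (reesAlgebra I).val.toLinearMap

theorem mem_reesGrading_iff {R : Type u} [CommRing R] {I : Ideal R} {d : ℕ}
    {f : reesAlgebra I} :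
    f ∈ reesGrading I d ↔ ∃ r : R, Polynomial.monomial d r = (f : Polynomial R) :=
  Iff.rfl

instance reesGrading_gradedMonoid {R : Type u} [CommRing R] (I : Ideal R) :
    SetLike.GradedMonoid (reesGrading I) where
  one_mem := ⟨1, rfl⟩
  mul_mem := by
    rintro i j f g ⟨r, hr⟩ ⟨s, hs⟩
    refine ⟨r * s, ?_⟩
    rw [← Polynomial.monomial_mul_monomial, hr, hs]
    rfl

/-- The homogeneous component of degree `d` of an element of the Rees algebra. -/
def reesComponent {R : Type u} [CommRing R] (I : Ideal R) (d : ℕ) (f : reesAlgebra I) :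
    reesGrading I d :=
  ⟨⟨Polynomial.monomial d ((f : Polynomial R).coeff d), reesAlgebra.monomial_mem.2 (f.2 d)⟩,
    ⟨_, rfl⟩⟩

instance reesGrading_decomposition {R : Type u} [CommRing R] (I : Ideal R) :
    DirectSum.Decomposition (reesGrading I) where
  decompose' f := DirectSum.mk (fun d => reesGrading I d) (f : Polynomial R).support
    (fun d => reesComponent I d f)
  left_inv f := by
    apply Subtype.ext
    classical
    have h : DirectSum.mk (fun d => reesGrading I d) (f : Polynomial R).support
          (fun d => reesComponent I d f) =
        ∑ d ∈ (f : Polynomial R).support,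
          DirectSum.of (fun d => reesGrading I d) d (reesComponent I d f) := by
      ext d : 1
      rw [DFinsupp.finsetSum_apply]
      by_cases hd : d ∈ (f : Polynomial R).support
      · rw [DirectSum.mk_apply_of_mem hd, Finset.sum_eq_single d, DirectSum.of_eq_same]
        · intro b _ hb
          exact DirectSum.of_eq_of_ne _ _ _ hb.symm
        · exact fun h => absurd hd h
      · rw [DirectSum.mk_apply_of_notMem hd, Finset.sum_eq_zero]
        intro b hb
        exact DirectSum.of_eq_of_ne _ _ _ (fun e => hd (e ▸ hb))
    refine (congrArg (fun x => (DirectSum.coeAddMonoidHom (reesGrading I) x).1) h).trans ?_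
    rw [map_sum, AddSubmonoidClass.coe_finsetSum]
    simp only [DirectSum.coeAddMonoidHom_of]
    exact ((f : Polynomial R).as_sum_support).symm
  right_inv x := by
    classical
    have key : ∀ (f : reesAlgebra I) (d : ℕ),
        (DirectSum.mk (fun d => reesGrading I d) (f : Polynomial R).support
          (fun d => reesComponent I d f)) d = reesComponent I d f := by
      intro f d
      by_cases hd : d ∈ (f : Polynomial R).support
      · rw [DirectSum.mk_apply_of_mem hd]
      · rw [DirectSum.mk_apply_of_notMem hd]
        apply Subtype.ext
        apply Subtype.ext
        have : (f : Polynomial R).coeff d = 0 := by simpa using hd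
        simp [reesComponent, this]
    ext d : 1
    rw [key]
    induction x using DirectSum.induction_on with
    | zero =>
      apply Subtype.ext
      apply Subtype.ext
      simp [reesComponent]
    | of i y =>
      rw [DirectSum.coeAddMonoidHom_of]
      obtain ⟨⟨p, hp⟩, r, rfl : Polynomial.monomial i r = p⟩ := y
      by_cases h : i = d
      · subst h
        rw [DirectSum.of_eq_same]
        apply Subtype.ext
        apply Subtype.ext
        simp [reesComponent]
      · rw [DirectSum.of_eq_of_ne _ _ _ (Ne.symm h)]
        apply Subtype.ext
        apply Subtype.ext
        simp [reesComponent, Polynomial.coeff_monomial, h]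
    | add x y hx hy =>
      rw [map_add, DirectSum.add_apply, ← hx, ← hy]
      apply Subtype.ext
      apply Subtype.ext
      simp [reesComponent]

instance reesGrading_gradedAlgebra {R : Type u} [CommRing R] (I : Ideal R) :
    GradedAlgebra (reesGrading I) where

/-- The blowup of `Spec R` with center the ideal `I`, that is `Proj` of the Rees algebra
`⨁ I ^ d`. -/
def blowup {R : Type u} [CommRing R] (I : Ideal R) : Scheme.{u} :=
  Proj (reesGrading I)

/-- The blowup map `π : Bl_I (Spec R) ⟶ Spec R`. -/
def blowupMap {R : Type u} [CommRing R] (I : Ideal R) : blowup I ⟶ Spec (CommRingCat.of R) :=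
  Proj.toSpecZero (reesGrading I) ≫
    Spec.map (CommRingCat.ofHom (algebraMap R (reesGrading I 0)))

/-- The structure morphism `𝔸ⁿ ⟶ Spec K` of affine space `𝔸ⁿ = Spec K[x₁, …, xₙ]`. -/
def affineSpaceToBase (K : Type u) [Field K] (n : ℕ) :
    Spec (CommRingCat.of (MvPolynomial (Fin n) K)) ⟶ Spec (CommRingCat.of K) :=
  Spec.map (CommRingCat.ofHom (algebraMap K (MvPolynomial (Fin n) K)))

/-- A monomial ideal: an ideal generated by a set of monomials. -/
def IsMonomialIdeal {K : Type u} [Field K] {n : ℕ} (I : Ideal (MvPolynomial (Fin n) K)) : Prop :=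
  ∃ A : Set (Fin n →₀ ℕ), I = Ideal.span ((fun a => MvPolynomial.monomial a (1 : K)) '' A)

/-- A tame ideal: a monomial ideal such that the blowup of `𝔸ⁿ` with this center is smooth
(over the ground field). -/
def IsTame {K : Type u} [Field K] {n : ℕ} (I : Ideal (MvPolynomial (Fin n) K)) : Prop :=
  IsMonomialIdeal I ∧ Smooth (blowupMap I ≫ affineSpaceToBase K n)

/-- A coordinate ideal: an ideal generated by a (possibly empty) subset of the variables. -/
def IsCoordinateIdeal {K : Type u} [Field K] {n : ℕ} (I : Ideal (MvPolynomial (Fin n) K)) :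
    Prop :=
  ∃ S : Set (Fin n), I = Ideal.span (MvPolynomial.X '' S)

end

/-! Write each factor as the ideal of the variables in a set `T P`. The product is generated by the
monomials `∏ x_{c P}` over choice functions `c`, and their charts cover the blowup. The chart of `c`
has coordinate ring `K[x]` with the ratios `x_v / x_{c P}`, `v ∈ T P`, adjoined. The point is to
find enough choices whose chart is an affine space.

Fix a point and take, among the choices whose chart contains it, one with least index sum. An
exchange argument makes it minimal entry by entry. Permuting the values of a choice does not change
its monomial, so this choice is `IsPermMinimal`. Swaps and 3-cycles of values then show, for linked
`T`, that `choiceLE` is a partial order whose lower sets are chains: a forest on the variables.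

On such a chart the substitution `x_v ↦ ∏_{u ≤ v} x_u` turns the ratio of `x_v` to its predecessor
into a coordinate. It identifies the chart with affine space (`smooth_chart_of_isPermMinimal`).
Pairwise unions of sets form a linked family (`isLinked_union`), which gives the theorem. -/

/-! ### Combinatorics of choice functions -/

/-- Any two elements of members of the family lie in a common member contained in the union of the
two. -/
def IsLinked {ι σ : Type*} (T : ι → Set σ) : Prop :=
  ∀ P Q u v, u ∈ T P → v ∈ T Q → ∃ R, u ∈ T R ∧ v ∈ T R ∧ T R ⊆ T P ∪ T Q

/-- A choice function for `T` no value of which can be decreased by permuting its values. -/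
structure IsPermMinimal {ι σ : Type*} [LE σ] (T : ι → Set σ) (c : ι → σ) : Prop where
  mem : ∀ P, c P ∈ T P
  le : ∀ τ : Equiv.Perm ι, (∀ P, c (τ P) ∈ T P) → ∀ P, c P ≤ c (τ P)

/-- The relation "`u = v`, or `u` is the chosen element of a member of `T` containing `v`". -/
def choiceLE {ι σ : Type*} (T : ι → Set σ) (c : ι → σ) (u v : σ) : Prop :=
  u = v ∨ ∃ P, c P = u ∧ v ∈ T P

namespace IsPermMinimal

variable {ι σ : Type*} [LinearOrder σ] {T : ι → Set σ} {c : ι → σ}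

theorem eq_of_swap (hc : IsPermMinimal T c) {P Q : ι} (hPQ : c Q ∈ T P) (hQP : c P ∈ T Q) :
    c P = c Q := by
  classical
  rcases eq_or_ne P Q with rfl | hne
  · rfl
  have h : ∀ R, c (Equiv.swap P Q R) ∈ T R := by
    intro R
    rcases eq_or_ne R P with rfl | hRP
    · simpa using hPQ
    rcases eq_or_ne R Q with rfl | hRQ
    · simpa using hQP
    rw [Equiv.swap_apply_of_ne_of_ne hRP hRQ]
    exact hc.mem R
  have h1 := hc.le _ h P
  have h2 := hc.le _ h Q
  rw [Equiv.swap_apply_left] at h1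
  rw [Equiv.swap_apply_right] at h2
  exact le_antisymm h1 h2

theorem eq_of_cycle (hc : IsPermMinimal T c) {P Q R : ι} (hP : c Q ∈ T P) (hQ : c R ∈ T Q)
    (hR : c P ∈ T R) : c P = c Q := by
  classical
  rcases eq_or_ne P Q with rfl | hPQ
  · rfl
  rcases eq_or_ne Q R with rfl | hQR
  · exact hc.eq_of_swap hP hR
  rcases eq_or_ne R P with rfl | hRP
  · exact hc.eq_of_swap hP hQ
  let τ : Equiv.Perm ι := Equiv.swap P Q * Equiv.swap Q R
  have τP : τ P = Q := by
    simp [τ, Equiv.swap_apply_of_ne_of_ne hPQ hRP.symm]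
  have τQ : τ Q = R := by
    simp [τ, Equiv.swap_apply_of_ne_of_ne hRP hQR.symm]
  have τR : τ R = P := by simp [τ]
  have h : ∀ X, c (τ X) ∈ T X := by
    intro X
    rcases eq_or_ne X P with rfl | hXP
    · rwa [τP]
    rcases eq_or_ne X Q with rfl | hXQ
    · rwa [τQ]
    rcases eq_or_ne X R with rfl | hXR
    · rwa [τR]
    have : τ X = X := by
      simp [τ, Equiv.swap_apply_of_ne_of_ne hXQ hXR, Equiv.swap_apply_of_ne_of_ne hXP hXQ]
    rw [this]
    exact hc.mem X
  have h1 := hc.le _ h P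
  have h2 := hc.le _ h Q
  have h3 := hc.le _ h R
  rw [τP] at h1
  rw [τQ] at h2
  rw [τR] at h3
  exact le_antisymm h1 (h2.trans h3)

theorem choiceLE_antisymm (hc : IsPermMinimal T c) {u v : σ} (h : choiceLE T c u v)
    (h' : choiceLE T c v u) : u = v := by
  rcases h with rfl | ⟨P, rfl, hP⟩
  · rfl
  rcases h' with rfl | ⟨Q, rfl, hQ⟩
  · rfl
  exact hc.eq_of_swap hP hQ

/-- Linkedness gives `R` containing both values with `c R` in `T P` or `T Q`. A swap then identifies
`c R` with `c P` or `c Q`, so that value is the chosen one in a set containing the other. -/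
theorem choiceLE_total (hc : IsPermMinimal T c) (hT : IsLinked T) (P Q : ι) :
    choiceLE T c (c P) (c Q) ∨ choiceLE T c (c Q) (c P) := by
  obtain ⟨R, hPR, hQR, hR⟩ := hT P Q _ _ (hc.mem P) (hc.mem Q)
  rcases hR (hc.mem R) with h | h
  · exact .inl (.inr ⟨R, (hc.eq_of_swap h hPR).symm, hQR⟩)
  · exact .inr (.inr ⟨R, (hc.eq_of_swap h hQR).symm, hPR⟩)

theorem choiceLE_trans (hc : IsPermMinimal T c) (hT : IsLinked T) {u v w : σ}
    (h : choiceLE T c u v) (h' : choiceLE T c v w) : choiceLE T c u w := by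
  rcases h with rfl | ⟨P, rfl, hP⟩
  · exact h'
  rcases h' with rfl | ⟨Q, rfl, hw⟩
  · exact .inr ⟨P, rfl, hP⟩
  obtain ⟨R, hPR, hwR, hR⟩ := hT P Q _ _ (hc.mem P) hw
  refine .inr ⟨R, ?_, hwR⟩
  rcases hR (hc.mem R) with h | h
  · exact hc.eq_of_swap hPR h
  -- Here `c R ∈ T Q`, `c Q ∈ T P` and `c P ∈ T R`: a 3-cycle, which no swap handles.
  · exact hc.eq_of_cycle hPR hP h

theorem choiceLE_chain (hc : IsPermMinimal T c) (hT : IsLinked T) {u v w : σ}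
    (hu : choiceLE T c u w) (hv : choiceLE T c v w) : choiceLE T c u v ∨ choiceLE T c v u := by
  rcases hu with rfl | ⟨P, rfl, hP⟩
  · exact .inr hv
  rcases hv with rfl | ⟨Q, rfl, hQ⟩
  · exact .inl (.inr ⟨P, rfl, hP⟩)
  exact hc.choiceLE_total hT P Q

end IsPermMinimal

/-! ### Charts of a blowup inside a fraction field -/

/-- The degree one element `m * T` of the Rees algebra of an ideal containing `m`. -/
noncomputable def reesDegreeOne {R : Type*} [CommRing R] {I : Ideal R} {m : R} (hm : m ∈ I) : reesAlgebra I :=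
  ⟨Polynomial.monomial 1 m, reesAlgebra.monomial_mem.2 (by simpa using hm)⟩

theorem reesDegreeOne_mem {R : Type u} [CommRing R] {I : Ideal R} {m : R} (hm : m ∈ I) :
    reesDegreeOne hm ∈ reesGrading I 1 :=
  ⟨m, rfl⟩

theorem exists_ringEquiv_of_range_eq {A B F : Type*} [CommRing A] [CommRing B] [CommRing F]
    (g : A →+* F) (h : B →+* F) (hg : Function.Injective g) (hh : Function.Injective h)
    (hr : Set.range g = Set.range h) : ∃ e : A ≃+* B, ∀ a, h (e a) = g a := by
  have H : ∀ a, ∃ b, h b = g a := fun a => by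
    change g a ∈ Set.range h
    exact hr ▸ Set.mem_range_self a
  choose e he using H
  have hsurj : Function.Surjective e := fun b => by
    obtain ⟨a, ha⟩ : h b ∈ Set.range g := hr ▸ Set.mem_range_self b
    exact ⟨a, hh ((he a).trans ha)⟩
  let e' : A →+* B :=
    { toFun := e
      map_one' := hh (by rw [he, map_one, map_one])
      map_mul' := fun x y => hh (by rw [map_mul, he, he, he, map_mul])
      map_zero' := hh (by rw [he, map_zero, map_zero])
      map_add' := fun x y => hh (by rw [map_add, he, he, he, map_add]) }
  exact ⟨RingEquiv.ofBijective e' ⟨fun x y hxy => hg (by rw [← he, ← he]; exact congrArg h hxy),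
    hsurj⟩, he⟩

section chart

variable {R B : Type u} [CommRing R] [CommRing B] {F : Type*}
  [Field F] [Algebra B F] {I : Ideal R} (θ : R →+* B)
  {m : R} (hm : m ∈ I) (hm0 : θ m ≠ 0)

/-- The evaluation `T ↦ 1 / θ m` on the Rees algebra. -/
noncomputable def reesEval (F : Type*) [Field F] [Algebra B F] (I : Ideal R) (m : R) :
    reesAlgebra I →+* F :=
  (Polynomial.eval₂RingHom ((algebraMap B F).comp θ)
    (algebraMap B F (θ m))⁻¹).comp (reesAlgebra I).val.toRingHom

theorem reesEval_of_monomial (x : reesAlgebra I) (d : ℕ) (r : R)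
    (h : Polynomial.monomial d r = (x : Polynomial R)) :
    reesEval θ F I m x = algebraMap B F (θ r) /
      algebraMap B F (θ m) ^ d := by
  have : reesEval θ F I m x = Polynomial.eval₂ ((algebraMap B F).comp θ)
    (algebraMap B F (θ m))⁻¹ (x : Polynomial R) := rfl
  rw [this, ← h, Polynomial.eval₂_monomial, inv_pow, div_eq_mul_inv]
  rfl

variable [FaithfulSMul B F]

include hm0 in
theorem algebraMap_apply_ne_zero : algebraMap B F (θ m) ≠ 0 := by
  simpa using hm0

include hm0 in
theorem isUnit_reesEval_reesDegreeOne : IsUnit (reesEval θ F I m (reesDegreeOne hm)) := by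
  rw [reesEval_of_monomial θ _ 1 m rfl, pow_one,
    div_self (algebraMap_apply_ne_zero (F := F) θ hm0)]
  exact isUnit_one

variable (F) in
/-- The map from the coordinate ring of the chart of a blowup given by `m ∈ I` to a field
containing `B` induced by a ring homomorphism `θ : R →+* B`. -/
noncomputable def reesAwayLift :
    HomogeneousLocalization.Away (reesGrading I) (reesDegreeOne hm) →+* F :=
  (IsLocalization.Away.lift (reesDegreeOne hm)
    (isUnit_reesEval_reesDegreeOne θ hm hm0) :
      Localization.Away (reesDegreeOne hm) →+* F).comp (algebraMap _ _)

theorem reesAwayLift_mk (d : ℕ) (x : reesAlgebra I)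
    (hx : x ∈ reesGrading I (d • 1)) (r : R)
    (hr : Polynomial.monomial d r = (x : Polynomial R)) :
    reesAwayLift F θ hm hm0
      (HomogeneousLocalization.Away.mk _ (reesDegreeOne_mem hm) d x hx) =
    algebraMap B F (θ r) / algebraMap B F (θ m) ^ d := by
  rw [reesAwayLift, RingHom.comp_apply, HomogeneousLocalization.algebraMap_apply,
    HomogeneousLocalization.Away.val_mk, Localization.mk_eq_mk', IsLocalization.Away.lift,
    IsLocalization.lift_mk'_spec]
  rw [reesEval_of_monomial θ x d r hr, map_pow, reesEval_of_monomial θ _ 1 m rfl, pow_one,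
    div_self (algebraMap_apply_ne_zero (F := F) θ hm0), one_pow, one_mul]

theorem reesAwayLift_algebraMap (r : R) :
    reesAwayLift F θ hm hm0
      (HomogeneousLocalization.fromZeroRingHom _ _ (algebraMap R (reesGrading I 0) r)) =
    algebraMap B F (θ r) := by
  rw [reesAwayLift, RingHom.comp_apply, HomogeneousLocalization.algebraMap_apply]
  have : (HomogeneousLocalization.fromZeroRingHom (reesGrading I)
      (Submonoid.powers (reesDegreeOne hm)) (algebraMap R (reesGrading I 0) r)).val =
      algebraMap _ _ (algebraMap R (reesAlgebra I) r) := by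
    rfl
  rw [this, IsLocalization.Away.lift_eq, reesEval_of_monomial θ _ 0 r rfl, pow_zero, div_one]

theorem exists_reesAway_mk_eq
    (z : HomogeneousLocalization.Away (reesGrading I) (reesDegreeOne hm)) :
    ∃ (d : ℕ) (r : R) (x : reesAlgebra I) (hx : x ∈ reesGrading I (d • 1)),
      r ∈ I ^ d ∧ Polynomial.monomial d r = (x : Polynomial R) ∧
      HomogeneousLocalization.Away.mk _ (reesDegreeOne_mem hm) d x hx = z := by
  obtain ⟨d, x, hx, rfl⟩ := HomogeneousLocalization.Away.mk_surjective _ (reesDegreeOne_mem hm) z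
  obtain ⟨r, hr⟩ := hx
  rw [smul_eq_mul, mul_one] at hr
  refine ⟨d, r, x, ⟨r, by simpa using hr⟩, ?_, hr, rfl⟩
  rw [← reesAlgebra.monomial_mem, hr]
  exact x.2

theorem reesAwayLift_injective (hθ : Function.Injective θ) :
    Function.Injective (reesAwayLift F θ hm hm0) := by
  rw [injective_iff_map_eq_zero]
  intro z hz
  obtain ⟨d, r, x, hx, -, hr, rfl⟩ := exists_reesAway_mk_eq hm z
  rw [reesAwayLift_mk θ hm hm0 d x hx r hr, div_eq_zero_iff] at hz
  rcases hz with hz | hz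
  · have hr0 : r = 0 := by
      apply hθ
      rw [map_zero]
      exact (FaithfulSMul.algebraMap_injective B F) (by rw [hz, map_zero])
    have hx0 : x = 0 := by
      apply Subtype.ext
      rw [← hr, hr0, map_zero]
      rfl
    apply HomogeneousLocalization.val_injective
    rw [HomogeneousLocalization.Away.val_mk, hx0, Localization.mk_zero,
      HomogeneousLocalization.val_zero]
  · exact absurd hz (pow_ne_zero _ (algebraMap_apply_ne_zero (F := F) θ hm0))

/-- The chart consists of the fractions `θ r / θ m ^ d` with `r ∈ I ^ d`. `hdvd` puts them all in
`B`, and `hgen` says that they exhaust `B`. -/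
theorem range_reesAwayLift (hdvd : ∀ r ∈ I, θ m ∣ θ r)
    (hgen : ∀ b, ∃ d, ∃ r ∈ I ^ d, θ r = b * θ m ^ d) :
    Set.range (reesAwayLift F θ hm hm0) = Set.range (algebraMap B F) := by
  have hne := algebraMap_apply_ne_zero (F := F) θ hm0
  apply Set.Subset.antisymm
  · rintro _ ⟨z, rfl⟩
    obtain ⟨d, r, x, hx, hrI, hr, rfl⟩ := exists_reesAway_mk_eq hm z
    have hle : I ≤ (Ideal.span {θ m}).comap θ := fun s hs =>
      Ideal.mem_span_singleton.2 (hdvd s hs)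
    have := Ideal.le_comap_pow θ d (Ideal.pow_right_mono hle d hrI)
    rw [Ideal.mem_comap, Ideal.span_singleton_pow, Ideal.mem_span_singleton] at this
    obtain ⟨b, hb⟩ := this
    refine ⟨b, ?_⟩
    rw [reesAwayLift_mk θ hm hm0 d x hx r hr, hb, map_mul, map_pow,
      mul_div_cancel_left₀ _ (pow_ne_zero _ hne)]
  · rintro _ ⟨b, rfl⟩
    obtain ⟨d, r, hr, h⟩ := hgen b
    let x : reesAlgebra I := ⟨Polynomial.monomial d r, reesAlgebra.monomial_mem.2 hr⟩
    have hx : x ∈ reesGrading I (d • 1) := ⟨r, by simp [x]⟩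
    refine ⟨HomogeneousLocalization.Away.mk _ (reesDegreeOne_mem hm) d x hx, ?_⟩
    rw [reesAwayLift_mk θ hm hm0 d x hx r rfl, h, map_mul, map_pow,
      mul_div_cancel_right₀ _ (pow_ne_zero _ hne)]

variable (F) in
include F hm0 in
theorem exists_reesAway_ringEquiv (hθ : Function.Injective θ) (hdvd : ∀ r ∈ I, θ m ∣ θ r)
    (hgen : ∀ b, ∃ d, ∃ r ∈ I ^ d, θ r = b * θ m ^ d) :
    ∃ e : HomogeneousLocalization.Away (reesGrading I) (reesDegreeOne hm) ≃+* B,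
      ∀ r, e (HomogeneousLocalization.fromZeroRingHom _ _ (algebraMap R (reesGrading I 0) r)) =
        θ r := by
  obtain ⟨e, he⟩ := exists_ringEquiv_of_range_eq (reesAwayLift F θ hm hm0) (algebraMap B F)
    (reesAwayLift_injective θ hm hm0 hθ) (FaithfulSMul.algebraMap_injective B F)
    (range_reesAwayLift θ hm hm0 hdvd hgen)
  refine ⟨e, fun r => FaithfulSMul.algebraMap_injective B F ?_⟩
  rw [he, reesAwayLift_algebraMap]

end chart

theorem smooth_awayι_comp_blowupMap {k R B : Type u} [CommRing k] [CommRing R] [CommRing B]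
    [IsDomain B] [Algebra k R] [Algebra k B] [Algebra.Smooth k B] {I : Ideal R} (θ : R →ₐ[k] B)
    (hθ : Function.Injective θ) {m : R} (hm : m ∈ I) (hm0 : θ m ≠ 0)
    (hdvd : ∀ r ∈ I, θ m ∣ θ r) (hgen : ∀ b, ∃ d, ∃ r ∈ I ^ d, θ r = b * θ m ^ d) :
    Smooth (Proj.awayι (reesGrading I) _ (reesDegreeOne_mem hm) one_pos ≫ blowupMap I ≫
      Spec.map (CommRingCat.ofHom (algebraMap k R))) := by
  obtain ⟨e, he⟩ := exists_reesAway_ringEquiv (FractionRing B) (θ : R →+* B) hm hm0 hθ hdvd hgen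
  have h : Proj.awayι (reesGrading I) _ (reesDegreeOne_mem hm) one_pos ≫ blowupMap I ≫
      Spec.map (CommRingCat.ofHom (algebraMap k R)) =
      Spec.map (CommRingCat.ofHom ((e.symm : B →+* _).comp (algebraMap k B))) := by
    refine (congrArg (_ ≫ ·) (Category.assoc (Proj.toSpecZero (reesGrading I)) _ _)).trans
      ((Proj.awayι_toSpecZero_assoc (reesGrading I) _ _ _ _).trans ?_)
    rw [← Spec.map_comp, ← Spec.map_comp]
    congr 1
    ext a : 2
    apply e.injective
    simp only [CommRingCat.hom_comp, CommRingCat.hom_ofHom, RingHom.comp_apply]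
    rw [he]
    simp
  rw [h, HasRingHomProperty.Spec_iff (P := @Smooth)]
  exact RingHom.Smooth.respectsIso.1
    (T := HomogeneousLocalization.Away (reesGrading I) (reesDegreeOne hm)) (algebraMap k B) e.symm
    (RingHom.smooth_algebraMap.2 ‹_›)

/-! ### The substitution attached to a forest order -/

section forest

open MvPolynomial

variable (K : Type*) [Field K] {σ : Type*} [Fintype σ] (r : σ → σ → Prop)

open Classical in
/-- The substitution `x_v ↦ ∏_{r u v} x_u`. -/
noncomputable def lowerProductHom : MvPolynomial σ K →ₐ[K] MvPolynomial σ K :=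
  aeval fun v => ∏ u ∈ Finset.univ.filter (r · v), X u

open Classical in
theorem lowerProductHom_X (v : σ) :
    lowerProductHom K r (X v) = ∏ u ∈ Finset.univ.filter (r · v), X u :=
  aeval_X _ _

theorem lowerProductHom_X_ne_zero (v : σ) : lowerProductHom K r (X v) ≠ 0 := by
  classical
  rw [lowerProductHom_X]
  exact Finset.prod_ne_zero_iff.2 fun u _ => X_ne_zero u

variable {r}

theorem lowerProductHom_X_dvd [IsTrans σ r] {u v : σ} (h : r u v) :
    lowerProductHom K r (X u) ∣ lowerProductHom K r (X v) := by
  classical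
  rw [lowerProductHom_X, lowerProductHom_X]
  apply Finset.prod_dvd_prod_of_subset
  intro w hw
  simp only [Finset.mem_filter, Finset.mem_univ, true_and] at hw ⊢
  exact _root_.trans hw h

/-- In a finite partial order in which all lower sets are chains, the substitution
`x_v ↦ ∏_{u ≤ v} x_u` maps `x_v` to `x_v` if `v` is minimal, and else to `x_v` times the image of
`x_u`, where `u` is the predecessor of `v`. -/
theorem lowerProductHom_X_eq [Std.Refl r] [IsTrans σ r] [Std.Antisymm r]
    (hr : ∀ u v w, r u w → r v w → r u v ∨ r v u) (v : σ) :
    lowerProductHom K r (X v) = X v ∨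
      ∃ u, u ≠ v ∧ r u v ∧ lowerProductHom K r (X v) = X v * lowerProductHom K r (X u) := by
  classical
  let L : σ → Finset σ := fun v => Finset.univ.filter (r · v)
  have memL : ∀ u v, u ∈ L v ↔ r u v := by simp [L]
  have hv : v ∈ L v := (memL _ _).2 (refl_of r v)
  have hX : ∀ v, lowerProductHom K r (X v) = ∏ u ∈ L v, X u := lowerProductHom_X K r
  rcases ((L v).erase v).eq_empty_or_nonempty with h | h
  · left
    rw [hX, ← Finset.insert_erase hv, h]
    simp
  · right
    -- The elements strictly below `v` form a chain, so the one with the largest lower set is the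
    -- predecessor of `v`.
    obtain ⟨u, hu, hmax⟩ := ((L v).erase v).exists_max_image (fun u => (L u).card) h
    rw [Finset.mem_erase, memL] at hu
    refine ⟨u, hu.1, hu.2, ?_⟩
    have hvu : v ∉ L u := fun h => hu.1 (antisymm_of r hu.2 ((memL _ _).1 h))
    have hL : L v = insert v (L u) := by
      ext w
      rw [Finset.mem_insert, memL, memL]
      refine ⟨fun hw => ?_, ?_⟩
      · by_cases hwv : w = v
        · exact .inl hwv
        right
        rcases hr u w v hu.2 hw with h | h
        · have hsub : L u ⊆ L w := fun x hx =>
            (memL _ _).2 (_root_.trans ((memL _ _).1 hx) h)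
          have := Finset.eq_of_subset_of_card_le hsub
            (hmax w (Finset.mem_erase.2 ⟨hwv, (memL _ _).2 hw⟩))
          rw [← memL, this, memL]
          exact refl_of r w
        · exact h
      · rintro (rfl | hw)
        · exact refl_of r w
        · exact _root_.trans hw hu.2
    rw [hX, hX, hL, Finset.prod_insert hvu]

/-- The substitution is undone in the fraction field by `x_v ↦ x_v / x_u`, with `u` the predecessor
of `v`, or `x_v ↦ x_v` for minimal `v`. Induction on the size of the lower set checks this. -/
theorem lowerProductHom_injective [Std.Refl r] [IsTrans σ r] [Std.Antisymm r]
    (hr : ∀ u v w, r u w → r v w → r u v ∨ r v u) :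
    Function.Injective (lowerProductHom K r) := by
  classical
  let F := FractionRing (MvPolynomial σ K)
  let x : σ → F := fun v => algebraMap (MvPolynomial σ K) F (X v)
  have hx : ∀ v, x v ≠ 0 := fun v => by
    simp only [x, ne_eq, FaithfulSMul.algebraMap_eq_zero_iff]
    exact X_ne_zero v
  have hq : ∀ v, ∃ q : F, (lowerProductHom K r (X v) = X v ∧ q = x v) ∨
      ∃ u, u ≠ v ∧ r u v ∧ lowerProductHom K r (X v) = X v * lowerProductHom K r (X u) ∧
        q = x v / x u := by
    intro v
    rcases lowerProductHom_X_eq K hr v with h | ⟨u, huv, hu, h⟩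
    · exact ⟨x v, .inl ⟨h, rfl⟩⟩
    · exact ⟨x v / x u, .inr ⟨u, huv, hu, h, rfl⟩⟩
  choose q hq using hq
  let η : MvPolynomial σ K →ₐ[K] F := aeval q
  have key : ∀ (d : ℕ) (v : σ), (Finset.univ.filter (r · v)).card = d →
      η (lowerProductHom K r (X v)) = x v := by
    intro d
    induction d using Nat.strong_induction_on with
    | _ d ih =>
      intro v hd
      rcases hq v with ⟨h, hqv⟩ | ⟨u, huv, hu, h, hqv⟩
      · rw [h, aeval_X, hqv]
      · have hlt : (Finset.univ.filter (r · u)).card < d := by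
          rw [← hd]
          apply Finset.card_lt_card
          refine Finset.ssubset_iff_subset_ne.2 ⟨fun w hw => ?_, fun heq => ?_⟩
          · simp only [Finset.mem_filter, Finset.mem_univ, true_and] at hw ⊢
            exact _root_.trans hw hu
          · have : v ∈ Finset.univ.filter (r · u) := by
              rw [heq]
              simpa using refl_of r v
            exact huv (antisymm_of r hu (by simpa using this))
        rw [h, map_mul, ih _ hlt u rfl, aeval_X, hqv, div_mul_cancel₀ _ (hx u)]
  have hcomp : η.comp (lowerProductHom K r) = IsScalarTower.toAlgHom K (MvPolynomial σ K) F := by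
    ext v
    exact key _ v rfl
  have hinj : Function.Injective (η.comp (lowerProductHom K r)) := by
    rw [hcomp]
    exact FaithfulSMul.algebraMap_injective (MvPolynomial σ K) F
  exact Function.Injective.of_comp (f := η) hinj

end forest

/-! ### Covering the blowup by charts of generators -/

/-- The Rees algebra is generated in degree one, so no point of `Proj` contains all the degree one
elements coming from generators of the ideal. -/
theorem irrelevant_reesGrading_le {R : Type u} [CommRing R] {S : Set R}
    {J : Ideal (reesAlgebra (Ideal.span S))}
    (h : ∀ s (hs : s ∈ S), reesDegreeOne (Ideal.subset_span hs) ∈ J) :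
    (HomogeneousIdeal.irrelevant (reesGrading (Ideal.span S))).toIdeal ≤ J := by
  have h1 : ∀ s (hs : s ∈ Ideal.span S), reesDegreeOne hs ∈ J := by
    intro s hs
    induction hs using Submodule.span_induction with
    | mem s hs => exact h s hs
    | zero =>
      convert! J.zero_mem
      exact Subtype.ext (Polynomial.monomial_zero_right 1)
    | add x y hx hy ihx ihy =>
      convert! J.add_mem ihx ihy
      exact Subtype.ext (map_add (Polynomial.monomial 1) x y)
    | smul a x hx ih =>
      convert! J.mul_mem_left (algebraMap R _ a) ih
      exact Subtype.ext Polynomial.C_mul_monomial.symm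
  rw [HomogeneousIdeal.irrelevant_eq_span, Ideal.span_le]
  intro z hz
  simp only [Set.mem_iUnion] at hz
  obtain ⟨d, hd, r, hr⟩ := hz
  have hrI : r ∈ Ideal.span S ^ d := by
    rw [← reesAlgebra.monomial_mem, hr]
    exact z.2
  obtain ⟨d, rfl⟩ := Nat.exists_eq_succ_of_ne_zero hd.ne'
  have hz : z = ⟨Polynomial.monomial (d + 1) r, reesAlgebra.monomial_mem.2 hrI⟩ :=
    Subtype.ext hr.symm
  rw [hz]
  clear hz hr z
  have hrI' : r ∈ Ideal.span S ^ d * Ideal.span S := by rwa [← pow_succ]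
  have : ∀ hr : r ∈ Ideal.span S ^ (d + 1), (⟨Polynomial.monomial (d + 1) r,
      reesAlgebra.monomial_mem.2 hr⟩ : reesAlgebra (Ideal.span S)) ∈ J := by
    induction hrI' using Submodule.mul_induction_on' with
    | mem_mul_mem a ha b hb =>
      intro _
      convert! J.mul_mem_left (⟨Polynomial.monomial d a, reesAlgebra.monomial_mem.2 ha⟩ :
        reesAlgebra (Ideal.span S)) (h1 b hb)
      change _ = Polynomial.monomial d a * Polynomial.monomial 1 b
      rw [Polynomial.monomial_mul_monomial]
    | add x hx y hy ihx ihy =>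
      intro _
      rw [← pow_succ] at hx hy
      convert! J.add_mem (ihx hx hx) (ihy hy hy)
      exact map_add (Polynomial.monomial (d + 1)) x y
  exact this hrI

theorem reesDegreeOne_mul_eq {R : Type u} [CommRing R] {I : Ideal R} {a b c d : R} (ha : a ∈ I)
    (hb : b ∈ I) (hc : c ∈ I) (hd : d ∈ I) (h : a * b = c * d) :
    reesDegreeOne ha * reesDegreeOne hb = reesDegreeOne hc * reesDegreeOne hd := by
  apply Subtype.ext
  change Polynomial.monomial 1 a * Polynomial.monomial 1 b =
    Polynomial.monomial 1 c * Polynomial.monomial 1 d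
  rw [Polynomial.monomial_mul_monomial, Polynomial.monomial_mul_monomial, h]

/-- If a point of the blowup of `I` lies in the charts of `a` and `b` in `I`, and
`a * b = c * d` with `c` and `d` in `I`, then it lies in the chart of `d`. -/
theorem reesDegreeOne_notMem_of_mul_eq {R : Type u} [CommRing R] {I : Ideal R}
    (x : Proj (reesGrading I)) {a b c d : R} (ha : a ∈ I)
    (hb : b ∈ I) (hc : c ∈ I) (hd : d ∈ I) (h : a * b = c * d)
    (hax : reesDegreeOne ha ∉ x.asHomogeneousIdeal)
    (hbx : reesDegreeOne hb ∉ x.asHomogeneousIdeal) :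
    reesDegreeOne hd ∉ x.asHomogeneousIdeal := fun hmem => by
  have h' := Ideal.mul_mem_left x.asHomogeneousIdeal.toIdeal (reesDegreeOne hc) hmem
  rw [← reesDegreeOne_mul_eq ha hb hc hd h] at h'
  exact (x.isPrime.mem_or_mem h').elim hax hbx

/-! ### Products of coordinate ideals over a linked family -/

section choice

open MvPolynomial

variable {K : Type u} [Field K] {n : ℕ} {ι : Type*} [Fintype ι] {T : ι → Set (Fin n)}

theorem prod_span_X_eq_span (T : ι → Set (Fin n)) :
    ∏ P, (Ideal.span (X '' T P) : Ideal (MvPolynomial (Fin n) K)) =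
      Ideal.span ((fun b : ι → Fin n => ∏ P, X (b P)) '' {b | ∀ P, b P ∈ T P}) := by
  rw [Ideal.prod_span]
  congr 1
  ext p
  rw [Set.mem_fintype_prod]
  constructor
  · rintro ⟨g, hg, rfl⟩
    choose b hb hbg using fun P => hg P
    exact ⟨b, hb, Finset.prod_congr rfl fun P _ => hbg P⟩
  · rintro ⟨b, hb, rfl⟩
    exact ⟨fun P => X (b P), fun P => ⟨b P, hb P, rfl⟩, rfl⟩

theorem prod_X_mem {b : ι → Fin n} (hb : ∀ P, b P ∈ T P) :
    ∏ P, X (b P) ∈ ∏ P, (Ideal.span (X '' T P) : Ideal (MvPolynomial (Fin n) K)) :=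
  Ideal.prod_mem_prod fun P _ => Ideal.subset_span ⟨b P, hb P, rfl⟩

theorem isMonomialIdeal_prod_span_X (T : ι → Set (Fin n)) :
    IsMonomialIdeal (∏ P, (Ideal.span (X '' T P) : Ideal (MvPolynomial (Fin n) K))) := by
  refine ⟨(fun b : ι → Fin n => ∑ P, Finsupp.single (b P) 1) '' {b | ∀ P, b P ∈ T P}, ?_⟩
  rw [prod_span_X_eq_span, Set.image_image]
  congr 2
  funext b
  exact (monomial_sum_one _ _).symm

theorem prod_X_update [DecidableEq ι] (f : ι → Fin n) (P : ι) (v : Fin n) :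
    (∏ Q, X (Function.update f P v Q) : MvPolynomial (Fin n) K) =
      X v * ∏ Q ∈ Finset.univ.erase P, X (f Q) := by
  rw [← Finset.mul_prod_erase _ _ (Finset.mem_univ P), Function.update_self]
  congr 1
  refine Finset.prod_congr rfl fun Q hQ => ?_
  rw [Function.update_of_ne (Finset.ne_of_mem_erase hQ)]

/-- Every point of the blowup of a product of coordinate ideals lies in the chart of a choice
function that is minimal under permutations. -/
theorem exists_isPermMinimal_mem_basicOpen
    (x : Proj (reesGrading (∏ P, (Ideal.span (X '' T P) : Ideal (MvPolynomial (Fin n) K))))) :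
    ∃ (c : ι → Fin n) (hc : IsPermMinimal T c),
      x ∈ Proj.basicOpen _ (reesDegreeOne (prod_X_mem (K := K) hc.mem)) := by
  classical
  let V : Set (ι → Fin n) :=
    {b | ∃ hb : ∀ P, b P ∈ T P, reesDegreeOne (prod_X_mem (K := K) hb) ∉ x.asHomogeneousIdeal}
  have hne : V.Nonempty := by
    by_contra hV
    rw [Set.not_nonempty_iff_eq_empty, Set.eq_empty_iff_forall_notMem] at hV
    apply x.not_irrelevant_le
    -- The ideal is generalized because the type of the Rees algebra depends on it, so the span
    -- description cannot simply be rewritten.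
    have key : ∀ {I : Ideal (MvPolynomial (Fin n) K)} {S : Set (MvPolynomial (Fin n) K)},
        I = Ideal.span S → ∀ J : Ideal (reesAlgebra I),
        (∀ s (hs : s ∈ I), s ∈ S → reesDegreeOne hs ∈ J) →
        (HomogeneousIdeal.irrelevant (reesGrading I)).toIdeal ≤ J := by
      rintro I S rfl J h
      exact irrelevant_reesGrading_le fun s hs => h s _ hs
    refine key (prod_span_X_eq_span T) x.asHomogeneousIdeal.toIdeal ?_
    rintro s hs ⟨b, hb, rfl⟩
    by_contra hs
    exact hV b ⟨hb, hs⟩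
  obtain ⟨c, ⟨hcT, hcx⟩, hmin⟩ := Set.exists_min_image V (fun b => ∑ P, (b P : ℕ))
    (Set.toFinite V) hne
  -- Exchanging the entries of `c` and `b` at `P` preserves the product of the two monomials, so the
  -- altered `c` stays in `V`. If `b P < c P`, its index sum would be smaller.
  have hle : ∀ b ∈ V, ∀ P, c P ≤ b P := by
    rintro b ⟨hbT, hbx⟩ P
    by_contra! hlt
    have hT' : ∀ Q, Function.update c P (b P) Q ∈ T Q := fun Q => by
      rcases eq_or_ne Q P with rfl | hQ
      · simpa using hbT Q
      · simpa [hQ] using hcT Q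
    have hT'' : ∀ Q, Function.update b P (c P) Q ∈ T Q := fun Q => by
      rcases eq_or_ne Q P with rfl | hQ
      · simpa using hcT Q
      · simpa [hQ] using hbT Q
    have hmul : (∏ Q, X (c Q) : MvPolynomial (Fin n) K) * ∏ Q, X (b Q) =
        (∏ Q, X (Function.update b P (c P) Q)) * ∏ Q, X (Function.update c P (b P) Q) := by
      rw [prod_X_update c, prod_X_update b,
        ← Finset.mul_prod_erase _ (fun Q => X (c Q)) (Finset.mem_univ P),
        ← Finset.mul_prod_erase _ (fun Q => X (b Q)) (Finset.mem_univ P)]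
      ring
    have hV : Function.update c P (b P) ∈ V :=
      ⟨hT', reesDegreeOne_notMem_of_mul_eq x _ _ (prod_X_mem hT'') _ hmul hcx hbx⟩
    refine (hmin _ hV).not_gt ?_
    refine Finset.sum_lt_sum (fun Q _ => ?_) ⟨P, Finset.mem_univ P, by simpa using hlt⟩
    rcases eq_or_ne Q P with rfl | hQ
    · simpa using hlt.le
    · simp [hQ]
  refine ⟨c, ⟨hcT, fun τ hτ P => hle (c ∘ τ) ⟨hτ, ?_⟩ P⟩, hcx⟩
  have hprod : reesDegreeOne (prod_X_mem (K := K) hτ) = reesDegreeOne (prod_X_mem (K := K) hcT) :=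
    Subtype.ext (congrArg (Polynomial.monomial 1)
      (Equiv.prod_comp τ fun P => (X (c P) : MvPolynomial (Fin n) K)))
  exact fun h => hcx (hprod ▸ h)

theorem smooth_chart_of_isPermMinimal (hT : IsLinked T) {c : ι → Fin n} (hc : IsPermMinimal T c) :
    Smooth (Proj.awayι (reesGrading _) _ (reesDegreeOne_mem (prod_X_mem (K := K) hc.mem)) one_pos ≫
      blowupMap _ ≫ affineSpaceToBase K n) := by
  classical
  let r := choiceLE T c
  have hrefl : Std.Refl r := ⟨fun _ => .inl rfl⟩
  have htrans : IsTrans (Fin n) r := ⟨fun _ _ _ => hc.choiceLE_trans hT⟩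
  have hanti : Std.Antisymm r := ⟨fun _ _ => hc.choiceLE_antisymm⟩
  have hchain : ∀ u v w, r u w → r v w → r u v ∨ r v u := fun _ _ _ => hc.choiceLE_chain hT
  let θ := lowerProductHom K r
  have : Algebra.Smooth K (MvPolynomial (Fin n) K) := {}
  refine smooth_awayι_comp_blowupMap θ (lowerProductHom_injective K hchain) _ ?_ ?_ ?_
  · rw [map_prod]
    exact Finset.prod_ne_zero_iff.2 fun P _ => lowerProductHom_X_ne_zero K r (c P)
  · intro p hp
    rw [prod_span_X_eq_span] at hp
    rw [← Ideal.mem_span_singleton, ← Ideal.mem_comap]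
    refine (Ideal.span_le.2 ?_) hp
    rintro _ ⟨b, hb, rfl⟩
    rw [SetLike.mem_coe, Ideal.mem_comap, Ideal.mem_span_singleton, map_prod, map_prod]
    exact Finset.prod_dvd_prod_of_dvd _ _ fun P _ =>
      lowerProductHom_X_dvd K (.inr ⟨P, rfl, hb P⟩)
  · intro b
    induction b using MvPolynomial.induction_on with
    | C a => exact ⟨0, C a, by simp, by simp [θ, lowerProductHom]⟩
    | add p q hp hq =>
      obtain ⟨d, s, hs, hsp⟩ := hp
      obtain ⟨e, t, ht, htq⟩ := hq
      set m : MvPolynomial (Fin n) K := ∏ P, X (c P)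
      have hm := prod_X_mem (K := K) hc.mem
      -- Common denominator `θ m ^ (d + e)`.
      refine ⟨d + e, s * m ^ e + t * m ^ d, add_mem ?_ ?_, ?_⟩
      · rw [pow_add]
        exact Ideal.mul_mem_mul hs (Ideal.pow_mem_pow hm e)
      · rw [add_comm, pow_add]
        exact Ideal.mul_mem_mul ht (Ideal.pow_mem_pow hm d)
      · rw [map_add, map_mul, map_mul, map_pow, map_pow, hsp, htq]
        ring
    | mul_X p v hp =>
      obtain ⟨d, s, hs, hsp⟩ := hp
      rcases lowerProductHom_X_eq K hchain v with h | ⟨u, huv, hu, h⟩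
      · refine ⟨d, s * X v, Ideal.mul_mem_right _ _ hs, ?_⟩
        rw [map_mul, hsp, h]
        ring
      · obtain ⟨P, rfl, hP⟩ := hu.resolve_left huv
        have hT' : ∀ Q, Function.update c P v Q ∈ T Q := fun Q => by
          rcases eq_or_ne Q P with rfl | hQ
          · simpa using hP
          · simpa [hQ] using hc.mem Q
        refine ⟨d + 1, s * ∏ Q, X (Function.update c P v Q), ?_, ?_⟩
        · rw [pow_succ]
          exact Ideal.mul_mem_mul hs (prod_X_mem hT')
        · have hprod : θ (∏ Q, X (Function.update c P v Q)) = X v * θ (∏ Q, X (c Q)) := by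
            rw [prod_X_update, ← Finset.mul_prod_erase _ (fun Q => X (c Q)) (Finset.mem_univ P),
              map_mul, map_mul, h, mul_assoc]
          rw [map_mul, hsp, hprod]
          ring

theorem isTame_prod_span_X (hT : IsLinked T) :
    IsTame (∏ P, (Ideal.span (X '' T P) : Ideal (MvPolynomial (Fin n) K))) := by
  refine ⟨isMonomialIdeal_prod_span_X T, ?_⟩
  have : IsZariskiLocalAtSource @Smooth.{u} :=
    HasRingHomProperty.instIsZariskiLocalAtSource (Q := RingHom.Smooth)
  refine IsZariskiLocalAtSource.of_iSup_eq_top (P := @Smooth)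
    (fun c : {c : ι → Fin n // IsPermMinimal T c} =>
      Proj.basicOpen (reesGrading _) (reesDegreeOne (prod_X_mem (K := K) c.2.mem))) ?_ ?_
  · refine top_le_iff.mp fun x _ => TopologicalSpace.Opens.mem_iSup.mpr ?_
    obtain ⟨c, hc, hx⟩ := exists_isPermMinimal_mem_basicOpen x
    exact ⟨⟨c, hc⟩, hx⟩
  · rintro ⟨c, hc⟩
    have h := IsZariskiLocalAtSource.comp (P := @Smooth) (smooth_chart_of_isPermMinimal hT hc)
      (Proj.basicOpenIsoSpec (reesGrading _) _
        (reesDegreeOne_mem (prod_X_mem (K := K) hc.mem)) one_pos).hom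
    rw [← Proj.basicOpenIsoSpec_inv_ι] at h
    simp only [Category.assoc, Iso.hom_inv_id_assoc] at h
    exact h

end choice

/-! ### Pairwise sums of coordinate ideals -/

theorem isLinked_union {N : ℕ} {σ : Type*} (S : Fin N → Set σ) :
    IsLinked fun P : {p : Fin N × Fin N // p.1 < p.2} => S P.1.1 ∪ S P.1.2 := by
  have key : ∀ P : {p : Fin N × Fin N // p.1 < p.2}, ∀ u ∈ S P.1.1 ∪ S P.1.2,
      ∃ i, u ∈ S i ∧ S i ⊆ S P.1.1 ∪ S P.1.2 := by
    rintro P u (hu | hu)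
    · exact ⟨_, hu, Set.subset_union_left⟩
    · exact ⟨_, hu, Set.subset_union_right⟩
  intro P Q u v hu hv
  obtain ⟨i, hui, hi⟩ := key P u hu
  obtain ⟨j, hvj, hj⟩ := key Q v hv
  rcases lt_trichotomy i j with h | rfl | h
  · exact ⟨⟨(i, j), h⟩, .inl hui, .inr hvj, Set.union_subset_union hi hj⟩
  -- There is no pair `(i, i)`, but `S i` lies in the set of `P`, which therefore already contains
  -- both elements.
  · exact ⟨P, hu, hi hvj, Set.subset_union_left⟩
  · exact ⟨⟨(j, i), h⟩, .inr hui, .inl hvj,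
      Set.union_subset (hj.trans Set.subset_union_right) (hi.trans Set.subset_union_left)⟩

theorem isTame_prod_add {K : Type u} [Field K] {n N : ℕ}
    (I : Fin N → Ideal (MvPolynomial (Fin n) K)) (hI : ∀ i, IsCoordinateIdeal (I i)) :
    IsTame (∏ p : Fin N × Fin N with p.1 < p.2, (I p.1 + I p.2)) := by
  choose S hS using hI
  have : ∏ p : Fin N × Fin N with p.1 < p.2, (I p.1 + I p.2) =
      ∏ P : {p : Fin N × Fin N // p.1 < p.2},
        Ideal.span (MvPolynomial.X '' (S P.1.1 ∪ S P.1.2)) := by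
    rw [Finset.prod_subtype (p := fun p : Fin N × Fin N => p.1 < p.2) _ (by simp)]
    refine Finset.prod_congr rfl fun P _ => ?_
    rw [Set.image_union, Ideal.span_union, ← hS, ← hS]
    rfl
  rw [this]
  exact isTame_prod_span_X (isLinked_union S)

theorem mainTheorem9 {K : Type u} [Field K] {n : ℕ} :
    (∀ (N : ℕ) (I : Fin N → Ideal (MvPolynomial (Fin n) K)), (∀ i, IsCoordinateIdeal (I i)) →
      IsTame (∏ p : Fin N × Fin N with p.1 < p.2, (I p.1 + I p.2))) ∧
    IsTame (∏ p : Fin n × Fin n with p.1 < p.2,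
      (Ideal.span {MvPolynomial.X p.1, MvPolynomial.X p.2} :
        Ideal (MvPolynomial (Fin n) K))) := by
  refine ⟨fun N I hI => isTame_prod_add I hI, ?_⟩
  have h := isTame_prod_add (fun i => (Ideal.span {MvPolynomial.X i} :
    Ideal (MvPolynomial (Fin n) K))) fun i => ⟨{i}, by rw [Set.image_singleton]⟩
  simp only [Ideal.span_insert]
  exact h
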